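/- Let $A$ be an associative ring with unit. Assume that $A$ is left coherent, i.e. every finitely generated left ideal of $A$ is finitely presented as a left $A$-module. A left $A$-module $J$ is called \emph{fp-injective} if the functor $\mathrm{Hom}_A(-,J)$ takes short exact sequences of finitely presented left $A$-modules to short exact sequences of abelian groups. Assume that every fp-injective left $A$-module has finite injective dimension (not assumed to be bounded uniformly). Let $\mathrm{Hot}(A\text{-mod})$ and $\mathrm{Hot}(A\text{-mod}_{\mathrm{inj}})$ be the homotopy categories of unbounded complexes of arbitrary, respectively injective, left $A$-modules. Call a complex of left $A$-modules \emph{coacyclic} if it belongs to the minimal full triangulated subcategory of $\mathrm{Hot}(A\text{-mod})$ (closed under isomorphisms) which contains the total complexes of all short exact sequences $0\to K^\bullet\to L^\bullet\to M^\bullet\to 0$ of complexes of left $A$-modules and is closed under infinite direct sums. The \emph{coderived category} $D^{\mathrm{co}}(A\text{-mod})$ is the Verdier quotient of $\mathrm{Hot}(A\text{-mod})$ by the full subcategory of coacyclic complexes. Then the functor $$\mathrm{Hot}(A\text{-mod}_{\mathrm{inj}})\longrightarrow D^{\mathrm{co}}(A\text{-mod})$$ obtained by composing the functor $\mathrm{Hot}(A\text{-mod}_{\mathrm{inj}})\to\mathrm{Hot}(A\text{-mod})$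 induced by the embedding $A\text{-mod}_{\mathrm{inj}}\to A\text{-mod}$ with the Verdier quotient functor $\mathrm{Hot}(A\text{-mod})\to D^{\mathrm{co}}(A\text{-mod})$ is a triangulated functor and an equivalence of categories, i.e. an equivalence of triangulated categories. -/

import Mathlib

open CategoryTheory Limits Pretriangulated ZeroObject

universe v u

noncomputable section

/-- A ring `A` is left coherent if every finitely generated left ideal of `A` is finitely
presented as a left `A`-module. -/
def IsLeftCoherentRing (A : Type u) [Ring A] : Prop :=
  ∀ I : Ideal A, I.FG → Module.FinitePresentation A I

/-- A left `A`-module `J` is fp-injective if the functor `Hom_A(-, J)` takes short exact sequences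
of finitely presented left `A`-modules to short exact sequences of abelian groups. -/
def IsFpInjective {A : Type u} [Ring A] (J : ModuleCat.{u} A) : Prop :=
  ∀ S : ShortComplex (ModuleCat.{u} A), S.ShortExact →
    Module.FinitePresentation A S.X₁ → Module.FinitePresentation A S.X₂ →
    Module.FinitePresentation A S.X₃ →
      (S.op.map (preadditiveYoneda.obj J)).ShortExact

/-- The total complex of a three-term complex `K ⟶ L ⟶ M` of complexes over `C`, with `M` placed
in column `0`: it is the iterated cone, the cone of the morphism `cone (K ⟶ L) ⟶ M` induced by
`L ⟶ M`; its term in degree `n` is `K (n + 2) ⊞ L (n + 1) ⊞ M n`. -/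
def totalComplex {C : Type u} [Category.{v} C] [Abelian C]
    (S : ShortComplex (CochainComplex C ℤ)) : CochainComplex C ℤ :=
  CochainComplex.mappingCone (CochainComplex.mappingCone.descShortComplex S)

section Coderived

variable (C : Type u) [Category.{v} C] [Abelian C]

/-- A strictly full triangulated subcategory of the homotopy category `Hot(C)` which is closed
under infinite direct sums and contains the total complexes of all short exact sequences of
complexes over `C`. -/
structure ContainsTotalsAndSums (P : ObjectProperty (HomotopyCategory C (ComplexShape.up ℤ))) :
    Prop where
  isTriangulated : P.IsTriangulated
  isClosedUnderIsomorphisms : P.IsClosedUnderIsomorphisms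
  isClosedUnderSums : ∀ ι : Type v, P.IsClosedUnderColimitsOfShape (Discrete ι)
  total_mem : ∀ S : ShortComplex (CochainComplex C ℤ), S.ShortExact →
    P ((HomotopyCategory.quotient C (ComplexShape.up ℤ)).obj (totalComplex S))

/-- The coacyclic complexes over `C`: the minimal full triangulated subcategory of `Hot(C)` closed
under infinite direct sums and containing the total complexes of all short exact sequences of
complexes over `C`. -/
def coacyclic : ObjectProperty (HomotopyCategory C (ComplexShape.up ℤ)) :=
  fun K ↦ ∀ P : ObjectProperty (HomotopyCategory C (ComplexShape.up ℤ)),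
    ContainsTotalsAndSums C P → P K

lemma coacyclic_containsTotalsAndSums : ContainsTotalsAndSums C (coacyclic C) where
  isTriangulated :=
    { exists_zero := ⟨0, isZero_zero _, fun P hP ↦ by
        have := hP.isTriangulated
        have := hP.isClosedUnderIsomorphisms
        exact P.prop_zero⟩
      isStableUnderShiftBy := fun n ↦ ⟨fun K hK P hP ↦ by
        have := hP.isTriangulated
        exact P.le_shift n _ (hK P hP)⟩
      ext₂' := fun T hT h₁ h₃ ↦ ObjectProperty.le_isoClosure _ _ (fun P hP ↦ by
        have := hP.isTriangulated
        have := hP.isClosedUnderIsomorphisms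
        exact P.ext_of_isTriangulatedClosed₂ T hT (h₁ P hP) (h₃ P hP)) }
  isClosedUnderIsomorphisms := ⟨fun e hX P hP ↦ by
    have := hP.isClosedUnderIsomorphisms
    exact P.prop_of_iso e (hX P hP)⟩
  isClosedUnderSums := fun ι ↦ ⟨by
    rintro X ⟨h⟩ P hP
    have := hP.isClosedUnderSums ι
    exact P.prop_of_isColimit h.isColimit (fun j ↦ h.prop_diag_obj j P hP)⟩
  total_mem := fun S hS P hP ↦ hP.total_mem S hS

instance : (coacyclic C).IsTriangulated := (coacyclic_containsTotalsAndSums C).isTriangulated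

instance : (coacyclic C).IsClosedUnderIsomorphisms :=
  (coacyclic_containsTotalsAndSums C).isClosedUnderIsomorphisms

/-- The coderived category `D^co(C)`: the Verdier quotient of `Hot(C)` by the coacyclic
complexes, with its triangulated structure. -/
abbrev CoderivedCategory := (coacyclic C).trW.Localization

/-- The triangulated functor `Hot(C_inj) ⥤ D^co(C)` induced by the embedding `C_inj ⥤ C` of the
full subcategory of injective objects: apply the embedding termwise, then the Verdier quotient
functor. -/
abbrev homotopyInjectivesToCoderived :
    HomotopyCategory (InjectiveObject C) (ComplexShape.up ℤ) ⥤ CoderivedCategory C :=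
  (ObjectProperty.ι (isInjective C)).mapHomotopyCategory (ComplexShape.up ℤ) ⋙ (coacyclic C).trW.Q

end Coderived

end

/-! Full faithfulness: if `J` is a complex of injectives, Hom into `J` turns a short exact sequence
of complexes into a short exact sequence of Hom complexes, so every map from its total complex to
`J` is null-homotopic (`nonempty_homotopy_zero_totalComplex`). Hence coacyclic complexes are left
orthogonal to complexes of injectives, and passing to the Verdier quotient does not change Hom into
`J`.

Essential surjectivity: a complex `M` is embedded in a sequential colimit along monomorphisms that
have coacyclic cones and factor termwise through injectives (`exists_mono_factoring`). A map from a
finitely generated module to a term of the colimit lives at a finite stage and extends one stage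
later, so the terms are fp-injective. So is their product, whose finite injective dimension bounds
all of theirs; a finite coresolution by complexes of injectives then puts the colimit in the
essential image. The cokernel of `M` in the colimit is a sequential colimit of coacyclic complexes,
hence coacyclic by the telescope sequence. -/

/-! ### Orthogonality of total complexes and complexes of injectives -/

section Orthogonality

variable {C : Type u} [Category.{v} C] [Abelian C]

open CochainComplex CochainComplex.HomComplex

/-- A cochain with values in a complex of injective objects extends along a monomorphism. -/
lemma CochainComplex.HomComplex.Cochain.exists_extension {K L J : CochainComplex C ℤ}
    (i : K ⟶ L) [Mono i] [∀ n, Injective (J.X n)] {n : ℤ} (α : Cochain K J n) :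
    ∃ β : Cochain L J n, (Cochain.ofHom i).comp β (zero_add n) = α :=
  ⟨Cochain.mk fun p q hpq ↦ Injective.factorThru (α.v p q hpq) (i.f p), by
    ext p q hpq
    simp⟩

/-- A cochain on the middle term of a short exact sequence of complexes which vanishes on the
subcomplex descends to the quotient. -/
lemma CochainComplex.HomComplex.Cochain.exists_descent {S : ShortComplex (CochainComplex C ℤ)}
    (hS : S.ShortExact) {J : CochainComplex C ℤ} {n : ℤ} (α : Cochain S.X₂ J n)
    (hα : (Cochain.ofHom S.f).comp α (zero_add n) = 0) :
    ∃ β : Cochain S.X₃ J n, (Cochain.ofHom S.g).comp β (zero_add n) = α := by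
  have H (p q : ℤ) (hpq : p + n = q) :
      ∃ b : S.X₃.X p ⟶ J.X q, S.g.f p ≫ b = α.v p q hpq := by
    have h := hS.map_of_exact (HomologicalComplex.eval C (ComplexShape.up ℤ) p)
    have := h.epi_g
    obtain ⟨b, hb⟩ := CokernelCofork.IsColimit.desc' h.gIsCokernel (α.v p q hpq) (by
      have := Cochain.congr_v hα p q hpq
      rw [Cochain.zero_cochain_comp_v, Cochain.ofHom_v, Cochain.zero_v] at this
      exact this)
    exact ⟨b, hb⟩
  choose b hb using H
  exact ⟨Cochain.mk b, by ext p q hpq; simp [hb]⟩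

lemma CochainComplex.nonempty_homotopy_zero_totalComplex {S : ShortComplex (CochainComplex C ℤ)}
    (hS : S.ShortExact) {J : CochainComplex C ℤ} [∀ n, Injective (J.X n)]
    (f : mappingCone (mappingCone.descShortComplex S) ⟶ J) : Nonempty (Homotopy f 0) := by
  have := hS.mono_f
  have := hS.epi_g
  let φ := mappingCone.descShortComplex S
  -- A null-homotopy of `f` amounts to cochains `γ₁` on the inner cone and `b` on `S.X₃` with `α = δ
  -- γ₁ + φ b` and `δ b = β`.
  let α : Cochain (mappingCone S.f) J (-1) :=
    (mappingCone.inl φ).comp (Cochain.ofHom f) (add_zero (-1))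
  let β : S.X₃ ⟶ J := mappingCone.inr φ ≫ f
  have hα : δ (-1) 0 α = (Cochain.ofHom φ).comp (Cochain.ofHom β) (zero_add 0) := by
    have := δ_comp_ofHom (mappingCone.inl φ) f 0
    rw [this, mappingCone.δ_inl]
    ext p
    simp [β]
  -- Injectivity enters here: the `S.X₁` component of `α` extends to `S.X₂`, and the coboundary of
  -- the extension removes it from `α`.
  obtain ⟨α₁, hα₁⟩ := Cochain.exists_extension (J := J) S.f
    ((mappingCone.inl S.f).comp α (show (-1) + (-1) = (-2 : ℤ) by lia))
  let γ₁ : Cochain (mappingCone S.f) J (-2) :=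
    -mappingCone.descCochain S.f (0 : Cochain _ _ (-3)) α₁ (by lia)
  have hγ₁ : (mappingCone.inl S.f).comp (δ (-2) (-1) γ₁) (show (-1) + (-1) = (-2 : ℤ) by lia) =
      (mappingCone.inl S.f).comp α (show (-1) + (-1) = (-2 : ℤ) by lia) := by
    have := mappingCone.δ_descCochain S.f (0 : Cochain _ J (-3)) α₁ (by lia) (-1) (by lia)
    rw [δ_neg, this]
    simp [hα₁]
  let γ := α - δ (-2) (-1) γ₁
  have hγ : (mappingCone.inl S.f).comp γ (show (-1) + (-1) = (-2 : ℤ) by lia) = 0 := by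
    simp only [γ, Cochain.comp_sub, hγ₁, sub_self]
  have hδγ : δ (-1) 0 γ = (Cochain.ofHom φ).comp (Cochain.ofHom β) (zero_add 0) := by
    simp [γ, hα, δ_δ]
  have hφ : (mappingCone.inl S.f).comp (Cochain.ofHom φ) (add_zero (-1)) = 0 := by
    ext p q hpq
    simp [φ]
  let τ := (Cochain.ofHom (mappingCone.inr S.f)).comp γ (zero_add (-1))
  -- Apply `δ` to `hγ`: the coboundary of `inl` is `S.f` followed by `inr`, while `δ γ` factors
  -- through `φ`, which kills `inl`.
  have hτ : (Cochain.ofHom S.f).comp τ (zero_add (-1)) = 0 := by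
    have h := congr_arg (δ (-2) (-1)) hγ
    rw [δ_comp _ _ _ 0 0 (-1) (by lia) (by lia) (by lia), hδγ,
      ← Cochain.comp_assoc_of_second_is_zero_cochain, hφ] at h
    simpa [τ] using h
  obtain ⟨b, hb⟩ := Cochain.exists_descent hS τ hτ
  have hδb : δ (-1) 0 b = Cochain.ofHom β := by
    have h := congr_arg (δ (-1) 0) hb
    simp only [τ, δ_ofHom_comp, hδγ] at h
    ext p
    have h' := Cochain.congr_v h p p (add_zero p)
    simpa [φ, cancel_epi] using h'
  refine ⟨mappingCone.descHomotopy φ f 0 γ₁ b ?_ ?_⟩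
  · have h : α = δ (-2) (-1) γ₁ + γ := by simp [γ]
    change α = _
    rw [Cochain.ofHom_zero, Cochain.comp_zero, add_zero]
    nth_rw 1 [h]
    congr 1
    rw [mappingCone.ext_cochain_from_iff _ (-2) (-1) (by lia)]
    constructor
    · rw [hγ, ← Cochain.comp_assoc_of_second_is_zero_cochain, hφ, Cochain.zero_comp]
    · change τ = _
      rw [← hb, ← Cochain.comp_assoc_of_first_is_zero_cochain, ← Cochain.ofHom_comp]
      simp [φ]
  · rw [comp_zero, Cochain.ofHom_zero, add_zero, hδb]

end Orthogonality

/-! ### Full faithfulness -/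

section

variable {C : Type u} [Category.{v} C] [Abelian C]

open CochainComplex

lemma HomotopyCategory.exists_iso_quotient_of_mem_essImage
    {Y : HomotopyCategory C (ComplexShape.up ℤ)}
    (hY : ((isInjective C).ι.mapHomotopyCategory (ComplexShape.up ℤ)).essImage Y) :
    ∃ (J : CochainComplex C ℤ) (_ : ∀ n, Injective (J.X n)),
      Nonempty ((HomotopyCategory.quotient C (ComplexShape.up ℤ)).obj J ≅ Y) := by
  obtain ⟨X, ⟨e⟩⟩ := hY
  obtain ⟨X, rfl⟩ := HomotopyCategory.quotient_obj_surjective X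
  exact ⟨((isInjective C).ι.mapHomologicalComplex _).obj X, fun n ↦ (X.X n).2, ⟨e⟩⟩

lemma HomotopyCategory.quotient_obj_mem_essImage (J : CochainComplex C ℤ)
    (hJ : ∀ n, Injective (J.X n)) :
    ((isInjective C).ι.mapHomotopyCategory (ComplexShape.up ℤ)).essImage
      ((HomotopyCategory.quotient C (ComplexShape.up ℤ)).obj J) :=
  ⟨(HomotopyCategory.quotient _ _).obj (J.liftObjectProperty (isInjective C) hJ), ⟨Iso.refl _⟩⟩

variable (C) in
lemma containsTotalsAndSums_leftOrthogonal :
    ContainsTotalsAndSums C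
      ((isInjective C).ι.mapHomotopyCategory (ComplexShape.up ℤ)).essImage.leftOrthogonal where
  isTriangulated := inferInstance
  isClosedUnderIsomorphisms := inferInstance
  isClosedUnderSums ι := ⟨by
    rintro X ⟨h⟩ Y f hY
    refine h.isColimit.hom_ext fun j ↦ ?_
    rw [comp_zero]
    exact h.prop_diag_obj j _ hY⟩
  total_mem S hS Y f hY := by
    obtain ⟨J, hJ, ⟨e⟩⟩ := HomotopyCategory.exists_iso_quotient_of_mem_essImage hY
    rw [← cancel_mono e.inv, zero_comp]
    obtain ⟨g, hg⟩ := (HomotopyCategory.quotient C (ComplexShape.up ℤ)).map_surjective (f ≫ e.inv)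
    rw [← hg, HomotopyCategory.eq_of_homotopy g 0 (nonempty_homotopy_zero_totalComplex hS g).some,
      Functor.map_zero]

variable (C) in
lemma essImage_le_rightOrthogonal_coacyclic :
    ((isInjective C).ι.mapHomotopyCategory (ComplexShape.up ℤ)).essImage ≤
      (coacyclic C).rightOrthogonal :=
  fun _ hY _ f hX ↦ hX _ (containsTotalsAndSums_leftOrthogonal C) f hY

lemma homotopyInjectivesToCoderived_map_bijective
    (X Y : HomotopyCategory (InjectiveObject C) (ComplexShape.up ℤ)) :
    Function.Bijective ((homotopyInjectivesToCoderived C).map : (X ⟶ Y) → _) := by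
  have h := (essImage_le_rightOrthogonal_coacyclic C _
    (Functor.obj_mem_essImage _ Y)).map_bijective_of_isTriangulated (coacyclic C).trW.Q
      (((isInjective C).ι.mapHomotopyCategory (ComplexShape.up ℤ)).obj X)
  exact h.comp
    ((Functor.FullyFaithful.ofFullyFaithful
      ((isInjective C).ι.mapHomotopyCategory (ComplexShape.up ℤ))).map_bijective X Y)

variable (C) in
lemma isTriangulated_homotopyInjectivesToCoderived :
    (homotopyInjectivesToCoderived C).IsTriangulated :=
  inferInstance

instance : (homotopyInjectivesToCoderived C).Full where
  map_surjective := (homotopyInjectivesToCoderived_map_bijective _ _).2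

instance : (homotopyInjectivesToCoderived C).Faithful where
  map_injective h := (homotopyInjectivesToCoderived_map_bijective _ _).1 h

/-! ### Two-out-of-three for short exact sequences of complexes -/

/-- A triangulated, strictly full subcategory of `Hot(C)` which contains the total complexes of
short exact sequences. -/
structure ContainsTotals (P : ObjectProperty (HomotopyCategory C (ComplexShape.up ℤ))) :
    Prop where
  isTriangulated : P.IsTriangulated
  isClosedUnderIsomorphisms : P.IsClosedUnderIsomorphisms
  total_mem : ∀ S : ShortComplex (CochainComplex C ℤ), S.ShortExact →
    P ((HomotopyCategory.quotient C (ComplexShape.up ℤ)).obj (totalComplex S))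

variable (C) in
lemma containsTotals_coacyclic : ContainsTotals (coacyclic C) where
  isTriangulated := inferInstance
  isClosedUnderIsomorphisms := inferInstance
  total_mem := (coacyclic_containsTotalsAndSums C).total_mem

namespace ContainsTotals

variable {P : ObjectProperty (HomotopyCategory C (ComplexShape.up ℤ))} (hP : ContainsTotals P)
  {S : ShortComplex (CochainComplex C ℤ)} (hS : S.ShortExact)

include hP

lemma prop_mappingCone_iff {K L : CochainComplex C ℤ} (f : K ⟶ L) :
    P ((HomotopyCategory.quotient C (ComplexShape.up ℤ)).obj (mappingCone f)) ↔
      P.trW ((HomotopyCategory.quotient C (ComplexShape.up ℤ)).map f) := by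
  have := hP.isTriangulated
  have := hP.isClosedUnderIsomorphisms
  exact (P.trW_iff_of_distinguished _
    (HomotopyCategory.mappingCone_triangleh_distinguished f)).symm

include hS

/-- The total complex is the cone of the canonical map from the cone of `S.f` to `S.X₃`, so modulo
`P` the two agree. -/
lemma prop_mappingCone_iff_prop_X₃ :
    P ((HomotopyCategory.quotient C (ComplexShape.up ℤ)).obj (mappingCone S.f)) ↔
      P ((HomotopyCategory.quotient C (ComplexShape.up ℤ)).obj S.X₃) := by
  have := hP.isTriangulated
  have := hP.isClosedUnderIsomorphisms
  have hT := HomotopyCategory.mappingCone_triangleh_distinguished (mappingCone.descShortComplex S)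
  have h₃ := hP.total_mem S hS
  exact ⟨fun h ↦ P.ext_of_isTriangulatedClosed₂ _ hT h h₃,
    fun h ↦ P.ext_of_isTriangulatedClosed₁ _ hT h h₃⟩

lemma prop_X₃ (h₁ : P ((HomotopyCategory.quotient C (ComplexShape.up ℤ)).obj S.X₁))
    (h₂ : P ((HomotopyCategory.quotient C (ComplexShape.up ℤ)).obj S.X₂)) :
    P ((HomotopyCategory.quotient C (ComplexShape.up ℤ)).obj S.X₃) := by
  have := hP.isTriangulated
  have := hP.isClosedUnderIsomorphisms
  exact (hP.prop_mappingCone_iff_prop_X₃ hS).1 (P.ext_of_isTriangulatedClosed₃ _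
    (HomotopyCategory.mappingCone_triangleh_distinguished S.f) h₁ h₂)

lemma prop_X₁ (h₂ : P ((HomotopyCategory.quotient C (ComplexShape.up ℤ)).obj S.X₂))
    (h₃ : P ((HomotopyCategory.quotient C (ComplexShape.up ℤ)).obj S.X₃)) :
    P ((HomotopyCategory.quotient C (ComplexShape.up ℤ)).obj S.X₁) := by
  have := hP.isTriangulated
  have := hP.isClosedUnderIsomorphisms
  exact P.ext_of_isTriangulatedClosed₁ _
    (HomotopyCategory.mappingCone_triangleh_distinguished S.f) h₂
      ((hP.prop_mappingCone_iff_prop_X₃ hS).2 h₃)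

end ContainsTotals

/-! ### Complexes of bounded injective dimension -/

variable (C) in
/-- The complexes which become isomorphic in the coderived category to a complex of injective
objects. -/
abbrev coderivedInjective : ObjectProperty (HomotopyCategory C (ComplexShape.up ℤ)) :=
  (homotopyInjectivesToCoderived C).essImage.inverseImage (coacyclic C).trW.Q

lemma isZero_of_coacyclic {X : HomotopyCategory C (ComplexShape.up ℤ)} (hX : coacyclic C X) :
    IsZero ((coacyclic C).trW.Q.obj X) := by
  have h : (coacyclic C).trW (0 : X ⟶ 0) := by
    refine ((coacyclic C).trW_iff_of_distinguished _ (contractible_distinguished₂ X)).2 ?_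
    exact (coacyclic C).le_shift 1 _ hX
  have := Localization.inverts (coacyclic C).trW.Q _ _ h
  exact (Functor.map_isZero (coacyclic C).trW.Q (isZero_zero _)).of_iso
    (asIso ((coacyclic C).trW.Q.map (0 : X ⟶ 0)))

variable (C) in
lemma coacyclic_le_coderivedInjective : coacyclic C ≤ coderivedInjective C :=
  fun _ hX ↦ (homotopyInjectivesToCoderived C).essImage.prop_of_isZero (isZero_of_coacyclic hX)

variable (C) in
lemma containsTotals_coderivedInjective : ContainsTotals (coderivedInjective C) where
  isTriangulated := inferInstance
  isClosedUnderIsomorphisms := inferInstance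
  total_mem S hS := coacyclic_le_coderivedInjective C _
    ((coacyclic_containsTotalsAndSums C).total_mem S hS)

lemma coderivedInjective_of_injective (J : CochainComplex C ℤ) (hJ : ∀ n, Injective (J.X n)) :
    coderivedInjective C ((HomotopyCategory.quotient C (ComplexShape.up ℤ)).obj J) := by
  obtain ⟨X, ⟨e⟩⟩ := HomotopyCategory.quotient_obj_mem_essImage J hJ
  exact ⟨X, ⟨(coacyclic C).trW.Q.mapIso e⟩⟩

/-- Every complex embeds in a complex of injective objects. -/
lemma CochainComplex.exists_mono_injective [EnoughInjectives C] (T : CochainComplex C ℤ) :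
    ∃ (J : CochainComplex C ℤ) (_ : ∀ n, Injective (J.X n)) (i : T ⟶ J), Mono i := by
  -- With zero differential on `I`, the termwise embeddings `β` need not form a chain map; in the
  -- cone of `𝟙 I` the extra component `-δ β` corrects this.
  let I : CochainComplex C ℤ :=
    { X n := Injective.under (T.X n)
      d _ _ := 0 }
  let β : HomComplex.Cochain T I 0 := HomComplex.Cochain.ofHoms fun n ↦ Injective.ι (T.X n)
  let α : HomComplex.Cocycle T I 1 := HomComplex.Cocycle.mk (-HomComplex.δ 0 1 β) 2 (by lia)
    (by simp [HomComplex.δ_δ])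
  let i : T ⟶ mappingCone (𝟙 I) := mappingCone.lift (𝟙 I) α β (by simp [α])
  refine ⟨mappingCone (𝟙 I), fun n ↦ ?_, i, ?_⟩
  · have (n : ℤ) : Injective (I.X n) := inferInstanceAs (Injective (Injective.under (T.X n)))
    have h := mappingCone.id_X (𝟙 I) n (n + 1) rfl
    let r : Retract ((mappingCone (𝟙 I)).X n) (I.X (n + 1) ⊞ I.X n) :=
      { i := biprod.lift ((mappingCone.fst (𝟙 I)).1.v n (n + 1) rfl)
          ((mappingCone.snd (𝟙 I)).v n n (add_zero n))
        r := biprod.desc ((mappingCone.inl (𝟙 I)).v (n + 1) n (by lia))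
          ((mappingCone.inr (𝟙 I)).f n)
        retract := by simpa using h }
    exact r.injective
  · have (n : ℤ) : Mono (i.f n) := by
      have h : i.f n ≫ (mappingCone.snd (𝟙 I)).v n n (add_zero n) = Injective.ι (T.X n) := by
        simp [i, β]
      exact mono_of_mono_fac h
    exact HomologicalComplex.mono_of_mono_f i this

lemma coderivedInjective_of_hasInjectiveDimensionLE [EnoughInjectives C] (n : ℕ)
    (T : CochainComplex C ℤ) (hT : ∀ k, HasInjectiveDimensionLE (T.X k) n) :
    coderivedInjective C ((HomotopyCategory.quotient C (ComplexShape.up ℤ)).obj T) := by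
  induction n generalizing T with
  | zero => exact coderivedInjective_of_injective T fun k ↦
      have := hT k
      injective_iff_hasInjectiveDimensionLT_one.2 this
  | succ n hn =>
    -- Dimension shifting for whole complexes: all terms of the cokernel drop in dimension at once,
    -- which is why the bound must be uniform.
    obtain ⟨J, hJ, i, hi⟩ := CochainComplex.exists_mono_injective T
    let S := ShortComplex.mk i (cokernel.π i) (cokernel.condition i)
    have hS : S.ShortExact :=
      { exact := ShortComplex.exact_of_g_is_cokernel _ (cokernelIsCokernel i) }
    refine (containsTotals_coderivedInjective C).prop_X₁ hS
      (coderivedInjective_of_injective J hJ) (hn _ fun k ↦ ?_)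
    have hSk := hS.map_of_exact (HomologicalComplex.eval C (ComplexShape.up ℤ) k)
    exact (hSk.hasInjectiveDimensionLT_X₃_iff n (hJ k)).2 (hT k)

end

/-! ### Coproducts in the homotopy category -/

section

variable {C : Type u} [Category.{v} C] [Abelian C]

open CochainComplex

lemma HomotopyCategory.isZero_quotient_mappingCocone_id (K : CochainComplex C ℤ) :
    IsZero ((HomotopyCategory.quotient C (ComplexShape.up ℤ)).obj (mappingCocone (𝟙 K))) := by
  have h : IsZero ((HomotopyCategory.quotient C (ComplexShape.up ℤ)).obj (mappingCone (𝟙 K))) := by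
    rw [IsZero.iff_id_eq_zero]
    refine ((HomotopyCategory.quotient C (ComplexShape.up ℤ)).map_id _).symm.trans ?_
    rw [HomotopyCategory.eq_of_homotopy _ _ (mappingCone.homotopyToZeroOfId K), Functor.map_zero]
  exact (Functor.map_isZero
    (CategoryTheory.shiftFunctor (HomotopyCategory C (ComplexShape.up ℤ)) (-1 : ℤ)) h).of_iso
    (((HomotopyCategory.quotient C (ComplexShape.up ℤ)).commShiftIso (-1 : ℤ)).app _)

/-- The contractible object depends only on `L`, so null-homotopies on the summands of a coproduct
assemble into a single factorization. -/
lemma CochainComplex.exists_mappingCocone_factorization {K L : CochainComplex C ℤ} (f : K ⟶ L)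
    (hf : (HomotopyCategory.quotient C (ComplexShape.up ℤ)).map f = 0) :
    ∃ g : K ⟶ mappingCocone (𝟙 L), g ≫ mappingCocone.fst (𝟙 L) = f := by
  obtain ⟨β, hβ⟩ := HomComplex.Cochain.equivHomotopy f 0
    (HomotopyCategory.homotopyOfEq f 0 (by rw [hf, Functor.map_zero]))
  rw [HomComplex.Cochain.ofHom_zero, add_zero] at hβ
  exact ⟨mappingCocone.lift (𝟙 L) f (-β) (by simp [hβ]), by simp⟩

lemma HomotopyCategory.existsUnique_desc {ι : Type*}
    (K : ι → CochainComplex C ℤ) [HasCoproduct K] (Z : CochainComplex C ℤ)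
    (f : ∀ j, (HomotopyCategory.quotient C (ComplexShape.up ℤ)).obj (K j) ⟶
      (HomotopyCategory.quotient C (ComplexShape.up ℤ)).obj Z) :
    ∃! g : (HomotopyCategory.quotient C (ComplexShape.up ℤ)).obj (∐ K) ⟶
        (HomotopyCategory.quotient C (ComplexShape.up ℤ)).obj Z,
      ∀ j, (HomotopyCategory.quotient C (ComplexShape.up ℤ)).map (Sigma.ι K j) ≫ g = f j := by
  choose f' hf' using fun j ↦
    (HomotopyCategory.quotient C (ComplexShape.up ℤ)).map_surjective (f j)
  refine ⟨(HomotopyCategory.quotient C (ComplexShape.up ℤ)).map (Sigma.desc f'), fun j ↦ ?_,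
    fun m hm ↦ ?_⟩
  · rw [← hf', ← Functor.map_comp, Sigma.ι_desc]
  · obtain ⟨m, rfl⟩ := (HomotopyCategory.quotient C (ComplexShape.up ℤ)).map_surjective m
    rw [← sub_eq_zero, ← Functor.map_sub]
    choose u hu using fun j ↦ exists_mappingCocone_factorization
      (Sigma.ι K j ≫ (m - Sigma.desc f')) (by
        rw [Preadditive.comp_sub, Functor.map_sub, Functor.map_comp, hm, Sigma.ι_desc, hf',
          sub_self])
    have hg : m - Sigma.desc f' = Sigma.desc u ≫ mappingCocone.fst (𝟙 Z) :=
      Sigma.hom_ext _ _ fun j ↦ by rw [Sigma.ι_desc_assoc, hu]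
    rw [hg, Functor.map_comp,
      (HomotopyCategory.isZero_quotient_mappingCocone_id Z).eq_of_tgt
        ((HomotopyCategory.quotient C (ComplexShape.up ℤ)).map (Sigma.desc u)) 0, zero_comp]

/-- The quotient functor to the homotopy category preserves coproducts. -/
noncomputable def HomotopyCategory.isColimitCofanQuotient {ι : Type*}
    (K : ι → CochainComplex C ℤ) [HasCoproduct K] :
    IsColimit (Cofan.mk ((HomotopyCategory.quotient C (ComplexShape.up ℤ)).obj (∐ K))
      fun j ↦ (HomotopyCategory.quotient C (ComplexShape.up ℤ)).map (Sigma.ι K j)) :=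
  Cofan.IsColimit.mk _
    (fun s ↦ (HomotopyCategory.existsUnique_desc K s.pt.as s.inj).choose)
    (fun s ↦ (HomotopyCategory.existsUnique_desc K s.pt.as s.inj).choose_spec.1)
    (fun s m hm ↦ (HomotopyCategory.existsUnique_desc K s.pt.as s.inj).choose_spec.2 m hm)

lemma ContainsTotalsAndSums.prop_sigma
    {P : ObjectProperty (HomotopyCategory C (ComplexShape.up ℤ))} (hP : ContainsTotalsAndSums C P)
    (K : ℕ → CochainComplex C ℤ) [HasCoproduct K]
    (hK : ∀ n, P ((HomotopyCategory.quotient C (ComplexShape.up ℤ)).obj (K n))) :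
    P ((HomotopyCategory.quotient C (ComplexShape.up ℤ)).obj (∐ K)) := by
  have := hP.isClosedUnderSums (ULift ℕ)
  have : P.IsClosedUnderColimitsOfShape (Discrete ℕ) :=
    .of_equivalence (J := Discrete (ULift.{v} ℕ)) (Discrete.equivalence Equiv.ulift)
  exact P.prop_of_isColimit (HomotopyCategory.isColimitCofanQuotient K) fun j ↦ hK j.as

/-! ### Embeddings factoring termwise through injectives -/

namespace CochainComplex.mappingCocone

variable {K L : CochainComplex C ℤ} (φ : K ⟶ L)

lemma hom_ext_f {p q : ℤ} (hpq : p + -1 = q) {X : C} {f g : X ⟶ (mappingCocone φ).X p}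
    (h₁ : f ≫ (fst φ).f p = g ≫ (fst φ).f p)
    (h₂ : f ≫ (snd φ).v p q hpq = g ≫ (snd φ).v p q hpq) : f = g := by
  rw [← Category.comp_id f, ← Category.comp_id g, ← id_X φ p q hpq, Preadditive.comp_add,
    Preadditive.comp_add, reassoc_of% h₁, reassoc_of% h₂]

lemma hom_ext_of_inl_inr {p q : ℤ} (hpq : p + -1 = q) {X : C} {f g : (mappingCocone φ).X p ⟶ X}
    (h₁ : (inl φ).v p p (add_zero p) ≫ f = (inl φ).v p p (add_zero p) ≫ g)
    (h₂ : (inr φ).1.v q p (by lia) ≫ f = (inr φ).1.v q p (by lia) ≫ g) : f = g := by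
  rw [← Category.id_comp f, ← Category.id_comp g, ← id_X φ p q hpq, Preadditive.add_comp,
    Preadditive.add_comp, Category.assoc, Category.assoc, Category.assoc, Category.assoc, h₁, h₂]

lemma δ_snd : HomComplex.δ (-1) 0 (snd φ) = -HomComplex.Cochain.ofHom (fst φ ≫ φ) := by
  have h : snd φ = descCochain φ (0 : HomComplex.Cochain K L (-1))
      (HomComplex.Cochain.ofHom (𝟙 L)) (by lia) := by
    simp [snd, descCochain, mappingCone.descCochain, Int.negOnePow_even 2 ⟨1, rfl⟩]
    rfl
  rw [h, δ_descCochain _ _ _ _ 1 (by lia)]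
  simp

end CochainComplex.mappingCocone

/-- A complex embeds in a complex in such a way that the cokernel is contractible and that the
embedding factors termwise through injective objects. -/
lemma CochainComplex.exists_mono_factoring [EnoughInjectives C] (W : CochainComplex C ℤ) :
    ∃ (W' : CochainComplex C ℤ) (j : W ⟶ W'), Mono j ∧
      (coacyclic C).trW ((HomotopyCategory.quotient C (ComplexShape.up ℤ)).map j) ∧
      ∀ k, ∃ (I : C) (_ : Injective I) (a : W.X k ⟶ I) (b : I ⟶ W'.X k), a ≫ b = j.f k := by
  obtain ⟨J, hJ, i, hi⟩ := CochainComplex.exists_mono_injective W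
  let π := cokernel.π i
  have hπ : i ≫ π = 0 := cokernel.condition i
  let S₀ := ShortComplex.mk i π hπ
  have hS₀ : S₀.ShortExact :=
    { exact := ShortComplex.exact_of_g_is_cokernel _ (cokernelIsCokernel i) }
  -- The cocone of `J ⟶ J/W` is a model of `W`; the zero second component makes `j` factor termwise
  -- through `J`.
  let j : W ⟶ mappingCocone π := mappingCocone.lift π i 0 (by simp [hπ])
  have hj : j ≫ mappingCocone.fst π = i := by simp [j]
  have : Mono j := by
    have : Mono (j ≫ mappingCocone.fst π) := by rwa [hj]
    exact mono_of_mono j (mappingCocone.fst π)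
  -- Given by `π` on `J` and the identity on the shifted cokernel, so its kernel is the kernel of
  -- `π`, namely `W`.
  let q : mappingCocone π ⟶ mappingCocone (𝟙 (cokernel i)) :=
    mappingCocone.lift _ (mappingCocone.fst π ≫ π) (mappingCocone.snd π) (by
      rw [mappingCocone.δ_snd, Category.comp_id, neg_add_cancel])
  have hjq : j ≫ q = 0 := by
    ext k
    refine mappingCocone.hom_ext_f _ (q := k + -1) rfl ?_ ?_
    · have := HomologicalComplex.congr_hom hπ k
      simpa [q, j] using this
    · simp [q, j]
  let S := ShortComplex.mk j q hjq
  have hS : S.ShortExact := by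
    refine HomologicalComplex.shortExact_of_degreewise_shortExact _ fun k ↦ ?_
    have h₀ := hS₀.map_of_exact (HomologicalComplex.eval C (ComplexShape.up ℤ) k)
    have hmono : Mono (S.map (HomologicalComplex.eval C (ComplexShape.up ℤ) k)).f :=
      inferInstanceAs (Mono (j.f k))
    have hepi : Epi (q.f k) := ⟨fun u v huv ↦ by
      have h₁ : (mappingCocone.inl π).v k k (add_zero k) ≫ q.f k =
          π.f k ≫ (mappingCocone.inl (𝟙 (cokernel i))).v k k (add_zero k) :=
        mappingCocone.hom_ext_f _ (q := k + -1) rfl (by simp [q]) (by simp [q])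
      have h₂ : (mappingCocone.inr π).1.v (k + -1) k (by lia) ≫ q.f k =
          (mappingCocone.inr (𝟙 (cokernel i))).1.v (k + -1) k (by lia) :=
        mappingCocone.hom_ext_f _ (q := k + -1) rfl (by simp [q]) (by simp [q])
      refine mappingCocone.hom_ext_of_inl_inr _ (q := k + -1) rfl ?_ ?_
      · rw [← cancel_epi (π.f k), ← reassoc_of% h₁, ← reassoc_of% h₁, huv]
      · rw [← h₂, Category.assoc, Category.assoc, huv]⟩
    have key {X : C} (x : X ⟶ (mappingCocone π).X k) (hx : x ≫ q.f k = 0) :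
        ∃ l : X ⟶ W.X k, l ≫ j.f k = x := by
      have hx₁ : (x ≫ (mappingCocone.fst π).f k) ≫ π.f k = 0 := by
        have := hx =≫ (mappingCocone.fst (𝟙 (cokernel i))).f k
        simpa [q] using this
      have hx₂ : x ≫ (mappingCocone.snd π).v k (k + -1) rfl = 0 := by
        have := hx =≫ (mappingCocone.snd (𝟙 (cokernel i))).v k (k + -1) rfl
        simpa [q] using this
      obtain ⟨l, hl⟩ : ∃ l : X ⟶ W.X k, l ≫ i.f k = x ≫ (mappingCocone.fst π).f k :=
        ⟨_, (KernelFork.IsLimit.lift' h₀.fIsKernel _ hx₁).2⟩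
      exact ⟨l, mappingCocone.hom_ext_f _ (q := k + -1) rfl (by simpa [j] using hl)
        (by simp [j, hx₂])⟩
    exact
      { exact := ShortComplex.exact_of_f_is_kernel _ (KernelFork.IsLimit.ofι' _ _
          fun x hx ↦ ⟨(key x hx).choose, (key x hx).choose_spec⟩)
        mono_f := hmono
        epi_g := hepi }
  refine ⟨_, j, this, ?_, fun k ↦
    ⟨J.X k, hJ k, i.f k, (mappingCocone.inl π).v k k (add_zero k), ?_⟩⟩
  · have h := (containsTotals_coacyclic C)
    rw [← h.prop_mappingCone_iff]
    refine (h.prop_mappingCone_iff_prop_X₃ hS).2 ?_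
    exact (coacyclic C).prop_of_isZero
      (HomotopyCategory.isZero_quotient_mappingCocone_id (cokernel i))
  · refine mappingCocone.hom_ext_f _ (q := k + -1) rfl ?_ ?_ <;> simp [j]

end

/-! ### Direct sums and sequential unions of modules -/

section

variable {A : Type u} [Ring A]

/-- The image of a leg of a cocone, as a submodule of its point. -/
abbrev ModuleCat.legRange {J : Type*} [Category* J] {F : J ⥤ ModuleCat.{u} A} (c : Cocone F)
    (j : J) : Submodule A c.pt :=
  LinearMap.range (show F.obj j →ₗ[A] c.pt from (c.ι.app j).hom)

lemma ModuleCat.iSup_range_eq_top_of_isColimit {J : Type*} [Category* J]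
    {F : J ⥤ ModuleCat.{u} A} {c : Cocone F} (hc : IsColimit c) :
    ⨆ j, ModuleCat.legRange c j = ⊤ := by
  let p := (⨆ j, ModuleCat.legRange c j).mkQ
  have hp : ModuleCat.ofHom p = 0 := hc.hom_ext fun j ↦ by
    ext x
    simp only [comp_zero]
    exact (Submodule.Quotient.mk_eq_zero _).2
      (Submodule.mem_iSup_of_mem j (LinearMap.mem_range_self _ x))
  rw [← Submodule.ker_mkQ (⨆ j, ModuleCat.legRange c j)]
  exact LinearMap.ker_eq_top.2 (congr_arg ModuleCat.Hom.hom hp)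

lemma ModuleCat.eq_zero_of_cofan {ι : Type*} [DecidableEq ι] {F : ι → ModuleCat.{u} A}
    {c : Cofan F} (hc : IsColimit c) (p : ∀ j, c.pt ⟶ F j)
    (hp : ∀ j, c.inj j ≫ p j = 𝟙 _) (hp' : ∀ i j, i ≠ j → c.inj i ≫ p j = 0)
    {x : c.pt} (hx : ∀ j, (p j).hom x = 0) : x = 0 := by
  have h : x ∈ ⨆ j : Discrete ι, ModuleCat.legRange c j := by
    rw [ModuleCat.iSup_range_eq_top_of_isColimit hc]
    trivial
  rw [Submodule.mem_iSup_iff_exists_finsupp] at h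
  obtain ⟨f, hf, rfl⟩ := h
  choose y hy using hf
  refine Finset.sum_eq_zero fun i _ ↦ ?_
  have hi : y i = 0 := by
    have h := hx i.as
    rw [Finsupp.sum, map_sum, Finset.sum_eq_single i] at h
    · rw [← hy i] at h
      have h' := congr_arg (fun f ↦ ModuleCat.Hom.hom f (y i)) (hp i.as)
      exact h'.symm.trans h
    · intro k _ hk
      rw [← hy k]
      exact congr_arg (fun f ↦ ModuleCat.Hom.hom f (y k))
        (hp' k.as i.as fun h ↦ hk (Discrete.ext h))
    · intro hi
      rw [Finsupp.notMem_support_iff.1 hi, map_zero]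
  change f i = 0
  rw [← hy i, hi, map_zero]

/-- The image of `f` is finitely generated, hence a compact submodule, so one member of the
increasing chain of leg images contains it; injectivity of that leg gives the lift. -/
lemma ModuleCat.exists_factorization_of_finite {F : ℕ ⥤ ModuleCat.{u} A} {c : Cocone F}
    (hc : IsColimit c) (hι : ∀ n, Mono (c.ι.app n)) {K : ModuleCat.{u} A} [Module.Finite A K]
    (f : K ⟶ c.pt) : ∃ (n : ℕ) (g : K ⟶ F.obj n), g ≫ c.ι.app n = f := by
  have hdir : Directed (· ≤ ·) fun n ↦ ModuleCat.legRange c n := by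
    refine (monotone_nat_of_le_succ fun n ↦ ?_).directed_le
    rintro _ ⟨x, rfl⟩
    exact ⟨(F.map (homOfLE n.le_succ)).hom x,
      congr_arg (fun f ↦ ModuleCat.Hom.hom f x) (c.w (homOfLE n.le_succ))⟩
  have hf : LinearMap.range f.hom ≤ sSup (Set.range fun n ↦ ModuleCat.legRange c n) := by
    rw [sSup_range, ModuleCat.iSup_range_eq_top_of_isColimit hc]
    exact le_top
  have hcpt : IsCompactElement (LinearMap.range f.hom) := by
    rw [← Submodule.fg_iff_compact]
    exact (Module.Finite.iff_fg.1 inferInstance)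
  obtain ⟨_, ⟨n, rfl⟩, hn⟩ := (CompleteLattice.isCompactElement_iff_le_of_directed_sSup_le _ _).1
    hcpt _ (Set.range_nonempty _) hdir.directedOn_range hf
  have hinj : Function.Injective (c.ι.app n).hom :=
    (ModuleCat.mono_iff_injective _).1 (hι n)
  let e := LinearEquiv.ofInjective _ hinj
  refine ⟨n, ModuleCat.ofHom (e.symm.toLinearMap ∘ₗ
    LinearMap.codRestrict _ f.hom fun x ↦ hn (LinearMap.mem_range_self _ x)), ?_⟩
  ext x
  exact congr_arg Subtype.val (e.apply_symm_apply
    ⟨f.hom x, hn (LinearMap.mem_range_self _ x)⟩)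

end

/-! ### Telescopes and the extension criterion for fp-injectivity -/

section

variable {A : Type u} [Ring A]

open CochainComplex

instance : AB5OfSize.{0, 0} (ModuleCat.{u} A) :=
  AB5OfSize_shrink.{0, 0, u, u} _

/-- The telescope sequence of a sequence of complexes. -/
noncomputable abbrev CochainComplex.telescope (Y : ℕ ⥤ CochainComplex (ModuleCat.{u} A) ℤ) :
    ShortComplex (CochainComplex (ModuleCat.{u} A) ℤ) :=
  ShortComplex.mk (X₁ := ∐ Y.obj) (X₂ := ∐ Y.obj) (X₃ := colimit Y)
    (Sigma.desc fun n ↦ Sigma.ι Y.obj n - Y.map (homOfLE n.le_succ) ≫ Sigma.ι Y.obj (n + 1))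
    (Sigma.desc (colimit.ι Y))
    (Sigma.hom_ext _ _ fun n ↦ by simp)

lemma CochainComplex.eq_zero_of_comp_sigma_π {Y : ℕ → CochainComplex (ModuleCat.{u} A) ℤ} {k : ℤ}
    {x : (∐ Y).X k} (hx : ∀ n, ((Sigma.π Y n).f k).hom x = 0) : x = 0 := by
  let hc := isColimitCofanMkObjOfIsColimit
    (HomologicalComplex.eval (ModuleCat.{u} A) (ComplexShape.up ℤ) k) _ _ (coproductIsCoproduct Y)
  refine ModuleCat.eq_zero_of_cofan hc (fun n ↦ (Sigma.π Y n).f k) (fun n ↦ ?_)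
    (fun m n hmn ↦ ?_) hx
  · change (Sigma.ι Y n).f k ≫ (Sigma.π Y n).f k = _
    rw [← HomologicalComplex.comp_f, Sigma.ι_π_eq_id]
    rfl
  · change (Sigma.ι Y m).f k ≫ (Sigma.π Y n).f k = _
    rw [← HomologicalComplex.comp_f, Sigma.ι_π_of_ne _ hmn]
    rfl

/-- The first map sends `(xₙ)` to an element with coordinates `x₀` and `xₘ₊₁` minus the image of
`xₘ`, so its kernel vanishes by induction on the coordinate; the universal property of the colimit
identifies the cokernel. -/
lemma CochainComplex.telescope_shortExact (Y : ℕ ⥤ CochainComplex (ModuleCat.{u} A) ℤ) :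
    (telescope Y).ShortExact := by
  let d := (telescope Y).f
  have hd (n : ℕ) : Sigma.ι Y.obj n ≫ d =
      Sigma.ι Y.obj n - Y.map (homOfLE n.le_succ) ≫ Sigma.ι Y.obj (n + 1) := by simp [d]
  have hd₀ : d ≫ Sigma.π Y.obj 0 = Sigma.π Y.obj 0 := Sigma.hom_ext _ _ fun n ↦ by
    rw [reassoc_of% hd, Preadditive.sub_comp, Category.assoc,
      Sigma.ι_π_of_ne (b := n + 1) (c := 0) _ (by lia), comp_zero, sub_zero]
  have hd₁ (m : ℕ) : d ≫ Sigma.π Y.obj (m + 1) =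
      Sigma.π Y.obj (m + 1) - Sigma.π Y.obj m ≫ Y.map (homOfLE m.le_succ) :=
    Sigma.hom_ext _ _ fun n ↦ by
      rw [reassoc_of% hd, Preadditive.sub_comp, Preadditive.comp_sub, Category.assoc]
      by_cases h : n = m
      · subst h
        simp
      · rw [Sigma.ι_π_of_ne (b := n + 1) (c := m + 1) _ (by lia),
          Sigma.ι_π_of_ne_assoc (b := n) (c := m) _ h, comp_zero, zero_comp]
  have hmono : Mono (telescope Y).f := by
    refine HomologicalComplex.mono_of_mono_f _ fun k ↦ ?_
    rw [ModuleCat.mono_iff_injective, injective_iff_map_eq_zero]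
    intro x hx
    replace hx : (d.f k).hom x = 0 := hx
    refine eq_zero_of_comp_sigma_π fun n ↦ ?_
    induction n with
    | zero =>
      rw [← hd₀]
      change ((Sigma.π Y.obj 0).f k).hom ((d.f k).hom x) = 0
      rw [hx, map_zero]
    | succ m hm =>
      have h := congr_arg (fun f : ∐ Y.obj ⟶ Y.obj (m + 1) ↦ (f.f k).hom x) (hd₁ m)
      change ((Sigma.π Y.obj (m + 1)).f k).hom ((d.f k).hom x) =
        ((Sigma.π Y.obj (m + 1)).f k).hom x -
          ((Y.map (homOfLE m.le_succ)).f k).hom (((Sigma.π Y.obj m).f k).hom x) at h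
      rw [hx, map_zero, hm, map_zero, sub_zero] at h
      exact h.symm
  have hepi : Epi (telescope Y).g :=
    ⟨fun u v h ↦ colimit.hom_ext fun n ↦ by
      simpa using Sigma.ι Y.obj n ≫= h⟩
  refine { exact := ShortComplex.exact_of_g_is_cokernel _ ?_ }
  refine CokernelCofork.IsColimit.ofπ' _ _ fun {Z} t ht ↦
    ⟨colimit.desc Y
      (Cocone.mk Z (NatTrans.ofSequence (fun n ↦ Sigma.ι Y.obj n ≫ t) fun n ↦ ?_)), ?_⟩
  · have h := Sigma.ι Y.obj n ≫= ht
    rw [reassoc_of% hd, comp_zero, Preadditive.sub_comp, sub_eq_zero, Category.assoc] at h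
    simpa using h.symm
  · exact Sigma.hom_ext _ _ fun n ↦ by simp

lemma coacyclic_colimit (Y : ℕ ⥤ CochainComplex (ModuleCat.{u} A) ℤ)
    (hY : ∀ n, coacyclic _ ((HomotopyCategory.quotient _ (ComplexShape.up ℤ)).obj (Y.obj n))) :
    coacyclic _ ((HomotopyCategory.quotient _ (ComplexShape.up ℤ)).obj (colimit Y)) :=
  have h := (coacyclic_containsTotalsAndSums (ModuleCat.{u} A)).prop_sigma Y.obj hY
  (containsTotals_coacyclic _).prop_X₃ (telescope_shortExact Y) h h

/-- A module is fp-injective if morphisms to it extend from finitely generated submodules. -/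
lemma isFpInjective_of_extension {J : ModuleCat.{u} A}
    (h : ∀ S : ShortComplex (ModuleCat.{u} A), S.ShortExact → Module.Finite A S.X₁ →
      ∀ f : S.X₁ ⟶ J, ∃ g : S.X₂ ⟶ J, S.f ≫ g = f) :
    IsFpInjective J := by
  intro S hS h₁ _ _
  have := hS.epi_g
  have hop := hS.op
  have := hop.mono_f
  refine { exact := hop.exact.map_of_mono_of_preservesKernel _ inferInstance inferInstance,
           mono_f := inferInstanceAs (Mono ((preadditiveYoneda.obj J).map S.op.f)),
           epi_g := ?_ }
  rw [AddCommGrpCat.epi_iff_surjective]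
  intro f
  obtain ⟨g, hg⟩ := h S hS inferInstance f
  exact ⟨g, hg⟩

end

/-! ### Uniform bound and essential surjectivity -/

section

variable {A : Type u} [Ring A]

open CochainComplex

/-- A sequential colimit of monomorphisms of modules which factor through injective modules has the
extension property of fp-injective modules. -/
lemma exists_extension_colimit_of_factoring {F : ℕ ⥤ ModuleCat.{u} A} {c : Cocone F}
    (hc : IsColimit c) (hι : ∀ n, Mono (c.ι.app n))
    (hF : ∀ n, ∃ (I : ModuleCat.{u} A) (_ : Injective I) (a : F.obj n ⟶ I)
      (b : I ⟶ F.obj (n + 1)), a ≫ b = F.map (homOfLE n.le_succ))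
    {K E : ModuleCat.{u} A} [Module.Finite A K] (i : K ⟶ E) [Mono i] (f : K ⟶ c.pt) :
    ∃ g : E ⟶ c.pt, i ≫ g = f := by
  obtain ⟨n, v, rfl⟩ := ModuleCat.exists_factorization_of_finite hc hι f
  obtain ⟨I, _, a, b, hab⟩ := hF n
  exact ⟨Injective.factorThru (v ≫ a) i ≫ b ≫ c.ι.app (n + 1), by
    rw [Injective.comp_factorThru_assoc, Category.assoc, reassoc_of% hab, c.w]⟩

/-- If all fp-injective modules have finite injective dimension, then a complex whose terms have
the extension property of fp-injective modules has terms of uniformly bounded injective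
dimension. -/
lemma exists_hasInjectiveDimensionLE_of_extension
    (hfin : ∀ J : ModuleCat.{u} A, IsFpInjective J → ∃ n : ℕ, HasInjectiveDimensionLE J n)
    (X : ℤ → ModuleCat.{u} A)
    (hX : ∀ k, ∀ S : ShortComplex (ModuleCat.{u} A), S.ShortExact → Module.Finite A S.X₁ →
      ∀ f : S.X₁ ⟶ X k, ∃ g : S.X₂ ⟶ X k, S.f ≫ g = f) :
    ∃ n : ℕ, ∀ k, HasInjectiveDimensionLE (X k) n := by
  -- Applying the hypothesis to the product of all terms makes the bound uniform, since each term is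
  -- a retract of it.
  obtain ⟨n, hn⟩ := hfin (∏ᶜ X) (isFpInjective_of_extension fun S hS h₁ f ↦ by
    choose g hg using fun k ↦ hX k S hS h₁ (f ≫ Pi.π X k)
    exact ⟨Pi.lift g, Pi.hom_ext _ _ fun k ↦ by simp [hg]⟩)
  refine ⟨n, fun k ↦ Retract.hasInjectiveDimensionLT (Y := ∏ᶜ X)
    { i := Pi.lift fun l ↦ if h : k = l then eqToHom (by rw [h]) else 0
      r := Pi.π X k } (n + 1)⟩

variable (M : CochainComplex (ModuleCat.{u} A) ℤ)

/-- The iteration of the construction of `CochainComplex.exists_mono_factoring`. -/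
noncomputable def CochainComplex.factoringSequence : ℕ → CochainComplex (ModuleCat.{u} A) ℤ
  | 0 => M
  | n + 1 => (CochainComplex.exists_mono_factoring (factoringSequence n)).choose

/-- The transition morphisms of `CochainComplex.factoringSequence`. -/
noncomputable def CochainComplex.factoringSequenceMap (n : ℕ) :
    factoringSequence M n ⟶ factoringSequence M (n + 1) :=
  (CochainComplex.exists_mono_factoring (factoringSequence M n)).choose_spec.choose

/-- The iteration of the construction of `CochainComplex.exists_mono_factoring`, as a functor. -/
noncomputable abbrev CochainComplex.factoringFunctor :
    ℕ ⥤ CochainComplex (ModuleCat.{u} A) ℤ :=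
  Functor.ofSequence (factoringSequenceMap M)

lemma CochainComplex.factoringFunctor_map_mono_trW (i j : ℕ) (φ : i ⟶ j) :
    Mono ((factoringFunctor M).map φ) ∧
      (coacyclic _).trW ((HomotopyCategory.quotient _ (ComplexShape.up ℤ)).map
        ((factoringFunctor M).map φ)) := by
  obtain ⟨d, rfl⟩ := Nat.exists_eq_add_of_le (leOfHom φ)
  induction d with
  | zero =>
    obtain rfl : φ = 𝟙 _ := Subsingleton.elim _ _
    refine ⟨by rw [CategoryTheory.Functor.map_id]; infer_instance, ?_⟩
    rw [CategoryTheory.Functor.map_id, CategoryTheory.Functor.map_id]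
    exact (coacyclic _).trW.id_mem _
  | succ d hd =>
    obtain rfl : φ = homOfLE (i.le_add_right d) ≫ homOfLE (i + d).le_succ := Subsingleton.elim _ _
    obtain ⟨h₁, h₂⟩ := hd (homOfLE (i.le_add_right d))
    have h := (CochainComplex.exists_mono_factoring
      (factoringSequence M (i + d))).choose_spec.choose_spec
    have := h.1
    rw [Functor.map_comp, Functor.map_comp, Functor.ofSequence_map_homOfLE_succ]
    exact ⟨mono_comp' h₁ h.1, (coacyclic _).trW.comp_mem _ _ h₂ h.2.1⟩

/-- If all fp-injective modules have finite injective dimension, then every complex is isomorphic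
in the coderived category to a complex of injective modules. -/
lemma coderivedInjective_of_isFpInjective
    (hfin : ∀ J : ModuleCat.{u} A, IsFpInjective J → ∃ n : ℕ, HasInjectiveDimensionLE J n) :
    coderivedInjective _ ((HomotopyCategory.quotient _ (ComplexShape.up ℤ)).obj M) := by
  let F := factoringFunctor M
  have hmono (i j : ℕ) (φ : i ⟶ j) : Mono (F.map φ) := (factoringFunctor_map_mono_trW M i j φ).1
  have hι (n : ℕ) : Mono (colimit.ι F n) :=
    (colimit.isColimit F).mono_ι_app_of_isFiltered n
  have hX (k : ℤ) (S : ShortComplex (ModuleCat.{u} A)) (hS : S.ShortExact)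
      (_ : Module.Finite A S.X₁) (f : S.X₁ ⟶ (colimit F).X k) :
      ∃ g : S.X₂ ⟶ (colimit F).X k, S.f ≫ g = f := by
    have := hS.mono_f
    refine exists_extension_colimit_of_factoring
      (isColimitOfPreserves (HomologicalComplex.eval _ (ComplexShape.up ℤ) k)
        (colimit.isColimit F)) (fun n ↦ inferInstanceAs (Mono ((colimit.ι F n).f k)))
      (fun n ↦ ?_) S.f f
    dsimp [F]
    rw [Functor.ofSequence_map_homOfLE_succ]
    exact (CochainComplex.exists_mono_factoring
      (factoringSequence M n)).choose_spec.choose_spec.2.2 k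
  obtain ⟨n, hn⟩ := exists_hasInjectiveDimensionLE_of_extension hfin (colimit F).X hX
  have hcolim := coderivedInjective_of_hasInjectiveDimensionLE n (colimit F) hn
  let τ : (Functor.const ℕ).obj M ⟶ F :=
    { app n := F.map (homOfLE n.zero_le)
      naturality i j φ := by
        have h : F.map (homOfLE j.zero_le) = F.map (homOfLE i.zero_le) ≫ F.map φ := by
          rw [← F.map_comp]
          rfl
        exact (Category.id_comp _).trans h }
  have : Mono τ := by
    have (n : ℕ) : Mono (τ.app n) := hmono 0 n (homOfLE n.zero_le)
    exact NatTrans.mono_of_mono_app τ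
  let S := ShortComplex.mk τ (cokernel.π τ) (cokernel.condition τ)
  have hS : S.ShortExact :=
    { exact := ShortComplex.exact_of_g_is_cokernel _ (cokernelIsCokernel τ) }
  -- At stage `n` this is the cokernel of `M ⟶ F n`, a monomorphism with coacyclic cone.
  have hY (n : ℕ) : coacyclic _
      ((HomotopyCategory.quotient _ (ComplexShape.up ℤ)).obj ((cokernel τ).obj n)) := by
    have h := hS.map_of_exact ((evaluation ℕ (CochainComplex (ModuleCat.{u} A) ℤ)).obj n)
    refine ((containsTotals_coacyclic _).prop_mappingCone_iff_prop_X₃ h).1 ?_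
    rw [(containsTotals_coacyclic _).prop_mappingCone_iff]
    exact (factoringFunctor_map_mono_trW M 0 n (homOfLE n.zero_le)).2
  -- Pass to the colimit over `ℕ`, where the constant diagram has colimit `M`; exactness of
  -- sequential colimits gives a short exact sequence starting with `M`.
  let T := colim.mapShortComplex S (isColimitConstCocone ℕ M) (colimit.cocone F)
    (colimit.cocone (cokernel τ)) (colimit.ι F 0) (colimMap (cokernel.π τ))
    (fun n ↦ by
      change 𝟙 M ≫ _ = F.map (homOfLE n.zero_le) ≫ _
      rw [colimit.cocone_ι, colimit.w]
      exact Category.id_comp _) (fun n ↦ by simp [S])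
  have hT : T.ShortExact :=
    { exact := colim.exact_mapShortComplex hS.exact _ (colimit.isColimit F)
        (colimit.isColimit (cokernel τ)) _ _ _ _
      mono_f := hι 0
      epi_g := inferInstanceAs (Epi (colimMap (cokernel.π τ))) }
  exact (containsTotals_coderivedInjective _).prop_X₁ hT hcolim
    (coacyclic_le_coderivedInjective _ _ (coacyclic_colimit _ hY))

end

/- As `IsFpInjective` only tests short exact sequences of modules all of which are finitely
presented, left coherence is not needed to see that the sequential colimits constructed above have
fp-injective terms. -/
theorem mainTheorem8 (A : Type u) [Ring A] (hA : IsLeftCoherentRing A)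
    (hfin : ∀ J : ModuleCat.{u} A, IsFpInjective J → ∃ n : ℕ, HasInjectiveDimensionLE J n) :
    (homotopyInjectivesToCoderived (ModuleCat.{u} A)).IsTriangulated ∧
      (homotopyInjectivesToCoderived (ModuleCat.{u} A)).IsEquivalence := by
  refine ⟨isTriangulated_homotopyInjectivesToCoderived _, ?_⟩
  have : (homotopyInjectivesToCoderived (ModuleCat.{u} A)).EssSurj := ⟨fun X ↦ by
    have := Localization.essSurj (coacyclic (ModuleCat.{u} A)).trW.Q
      (coacyclic (ModuleCat.{u} A)).trW
    obtain ⟨K, hK⟩ := HomotopyCategory.quotient_obj_surjective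
      ((coacyclic (ModuleCat.{u} A)).trW.Q.objPreimage X)
    have h := coderivedInjective_of_isFpInjective K hfin
    rw [hK] at h
    exact (homotopyInjectivesToCoderived _).essImage.prop_of_iso
      ((coacyclic (ModuleCat.{u} A)).trW.Q.objObjPreimageIso X) h⟩
  exact { }
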